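/- For a permutation $\sigma=(\sigma_1,\dots,\sigma_n)$ of $\{1,\dots,n\}$, let $\mathrm{Des}(\sigma)=\{i : 1\le i\le n-1,\ \sigma_i>\sigma_{i+1}\}$, $\mathrm{des}(\sigma)=|\mathrm{Des}(\sigma)|$ and $\mathrm{maj}(\sigma)=\sum_{i\in \mathrm{Des}(\sigma)} i$. Let $\mathcal S_n(321)$ be the set of permutations of $\{1,\dots,n\}$ that avoid the pattern $321$, i.e. for which there are no $i<j<k$ with $\sigma_i>\sigma_j>\sigma_k$, and define the polynomials $g_{321,n,i}(q)$ by $$\sum_{\sigma\in\mathcal S_n(321)} q^{\mathrm{maj}(\sigma)}t^{\mathrm{des}(\sigma)}=\sum_{i\ge 0} t^i\, g_{321,n,i}(q).$$ Let $C_j=\frac1{j+1}\binom{2j}{j}$ be the $j$-th Catalan number, let $n\ge 0$ and put $m=\lfloor n/2\rfloor$. Then $m$ is the maximal number of descents of a permutation in $\mathcal S_n(321)$, and $$g_{321,n,m}(q)=\begin{cases} C_m\, q^{m^2} & \text{if } n \text{ is even},\\[4pt] \dfrac{4m+2}{m+2}\, C_m\left(q^{m^2}+q^{m^2+1}+\dots+q^{m^2+m}\right)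 & \text{if } n \text{ is odd}.\end{cases}$$ -/

import Mathlib

open Polynomial

namespace PatternMaj

/-- The permutation `σ = (σ₁, …, σₙ)` contains the pattern `π = (π₁, …, πₖ)`: some subsequence
`(σ_{i₁}, …, σ_{iₖ})`, `i₁ < ⋯ < iₖ`, is order-isomorphic to `π`. -/
def Contains {k n : ℕ} (π : Equiv.Perm (Fin k)) (σ : Equiv.Perm (Fin n)) : Prop :=
  ∃ f : Fin k → Fin n, StrictMono f ∧ ∀ a b, σ (f b) < σ (f a) ↔ π b < π a

/-- `σ` avoids the pattern `π`. -/
def Avoids {k n : ℕ} (π : Equiv.Perm (Fin k)) (σ : Equiv.Perm (Fin n)) : Prop :=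
  ¬ Contains π σ

/-- The pattern `321`, that is, the order-reversing permutation of three letters. -/
def pattern321 : Equiv.Perm (Fin 3) := Fin.revPerm

/-- The descent set `Des σ = {i : σᵢ > σᵢ₊₁}`, with positions numbered `1, …, n`
(position `i` is the element `i - 1` of `Fin n`). -/
def desSet {n : ℕ} (σ : Equiv.Perm (Fin n)) : Finset ℕ :=
  {i ∈ Finset.Icc 1 n | ∃ h : i < n, σ ⟨i, h⟩ < σ ⟨i - 1, (Nat.sub_le i 1).trans_lt h⟩}

/-- The descent number. -/
def des {n : ℕ} (σ : Equiv.Perm (Fin n)) : ℕ := (desSet σ).card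

/-- The major index, the sum of the descent positions. -/
def maj {n : ℕ} (σ : Equiv.Perm (Fin n)) : ℕ := ∑ i ∈ desSet σ, i

open Classical in
/-- `S_n(π)`, the set of permutations of length `n` that avoid `π`. -/
noncomputable def avoiders {k : ℕ} (π : Equiv.Perm (Fin k)) (n : ℕ) :
    Finset (Equiv.Perm (Fin n)) :=
  {σ | Avoids π σ}

/-- `F_{π,n} = ∑_{σ ∈ S_n(π)} q^{maj σ} t^{des σ}`, as a polynomial in `t` (outer variable)
over the polynomials in `q` (inner variable). -/
noncomputable def F {k : ℕ} (π : Equiv.Perm (Fin k)) (n : ℕ) : ℚ[X][X] :=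
  ∑ σ ∈ avoiders π n, C (X ^ maj σ) * X ^ des σ

/-- `g_{π,n,i}(q)`, the coefficient of `t^i` in `F_{π,n}`. -/
noncomputable def g {k : ℕ} (π : Equiv.Perm (Fin k)) (n i : ℕ) : ℚ[X] :=
  (F π n).coeff i

end PatternMaj

namespace PatternMaj

/-! Two consecutive descents form a `321`, so the descent set of an avoider contains no two
consecutive integers. Each pair {1,2}, {3,4}, … then holds at most one descent, which gives the
bound ⌊n/2⌋ (`des_le`). When the bound is attained every pair below 2m + 1 is used exactly once, and
after an even choice all later choices are even. The possible sets are therefore `sparseSet m k`,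
with k odd elements followed by m - k even ones and with sum m² + (m - k) (`exists_eq_sparseSet`,
`sum_sparseSet`). For n = 2m only k = m fits; for n = 2m + 1 every k ≤ m does.

It remains to count the avoiders with each descent set. For odd length the number does not depend on
k: a Knuth move on three adjacent entries trades the descent 2k + 2 for 2k + 1 and keeps
`321`-avoidance (`card_avoidersDes_succ`). For k = m, inserting the largest letter before the last
entry gives a bijection onto the extremal avoiders of length 2m + 2 (`card_avoidersDes_insert_max`).
In even length, the entries at even and at odd positions form the rows of a 2 × m standard tableau,
equivalently a Dyck word, so the count is a Catalan number (`card_avoidersDes_even`). The odd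
coefficient is thus C_{m+1}, rewritten through C_m by `catalan_succ_eq_div_mul`. -/

/-- The one-line notation of `σ`, as a sequence of natural numbers indexed from `0`. -/
def seq {n : ℕ} (σ : Equiv.Perm (Fin n)) (i : ℕ) : ℕ :=
  if h : i < n then (σ ⟨i, h⟩ : ℕ) else i

/-! ### One-line notation, descents and avoidance on natural-number indices. -/

section seq

variable {n : ℕ}

lemma seq_of_lt (σ : Equiv.Perm (Fin n)) {i : ℕ} (h : i < n) : seq σ i = σ ⟨i, h⟩ := by
  simp [seq, h]

lemma seq_lt (σ : Equiv.Perm (Fin n)) {i : ℕ} (h : i < n) : seq σ i < n := by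
  rw [seq_of_lt σ h]; exact (σ _).2

lemma seq_inj (σ : Equiv.Perm (Fin n)) {i j : ℕ} (hi : i < n) (hj : j < n)
    (h : seq σ i = seq σ j) : i = j := by
  rw [seq_of_lt σ hi, seq_of_lt σ hj] at h
  simpa using σ.injective (Fin.ext h)

lemma exists_seq_eq (σ : Equiv.Perm (Fin n)) {v : ℕ} (hv : v < n) : ∃ i < n, seq σ i = v :=
  ⟨σ.symm ⟨v, hv⟩, (σ.symm _).2, by simp [seq]⟩

lemma perm_ext {σ τ : Equiv.Perm (Fin n)} (h : ∀ i < n, seq σ i = seq τ i) : σ = τ := by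
  ext i
  have := h i i.2
  rwa [seq_of_lt σ i.2, seq_of_lt τ i.2] at this

lemma exists_perm_of_injOn (f : ℕ → ℕ) (hf : ∀ i < n, f i < n)
    (hinj : ∀ i < n, ∀ j < n, f i = f j → i = j) :
    ∃ σ : Equiv.Perm (Fin n), ∀ i < n, seq σ i = f i := by
  have hbij : Function.Bijective (fun i : Fin n => (⟨f i, hf i i.2⟩ : Fin n)) := by
    rw [← Finite.injective_iff_bijective]
    intro i j hij
    exact Fin.ext (hinj i i.2 j j.2 (by simpa using hij))
  exact ⟨Equiv.ofBijective _ hbij, fun i hi => by simp [seq, hi]⟩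

lemma mem_desSet {σ : Equiv.Perm (Fin n)} {i : ℕ} :
    i ∈ desSet σ ↔ 1 ≤ i ∧ i < n ∧ seq σ i < seq σ (i - 1) := by
  simp only [desSet, Finset.mem_filter, Finset.mem_Icc]
  constructor
  · rintro ⟨⟨h1, -⟩, h, hlt⟩
    refine ⟨h1, h, ?_⟩
    rw [seq_of_lt σ h, seq_of_lt σ ((Nat.sub_le i 1).trans_lt h)]
    exact hlt
  · rintro ⟨h1, h, hlt⟩
    refine ⟨⟨h1, h.le⟩, h, ?_⟩
    rw [seq_of_lt σ h, seq_of_lt σ ((Nat.sub_le i 1).trans_lt h)] at hlt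
    exact hlt

lemma avoids_iff {σ : Equiv.Perm (Fin n)} :
    Avoids pattern321 σ ↔
      ∀ i j l, i < j → j < l → l < n → seq σ l < seq σ j → seq σ j < seq σ i → False := by
  constructor
  · intro h i j l hij hjl hl h1 h2
    have hj := hjl.trans hl
    have hi := hij.trans hj
    rw [seq_of_lt σ hl, seq_of_lt σ hj] at h1
    rw [seq_of_lt σ hj, seq_of_lt σ hi] at h2
    rw [Fin.val_fin_lt] at h1 h2
    have h3 := h1.trans h2
    refine h ⟨![⟨i, hi⟩, ⟨j, hj⟩, ⟨l, hl⟩], ?_, ?_⟩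
    · intro a b hab
      fin_cases a <;> fin_cases b <;> simp_all <;> omega
    · intro a b
      fin_cases a <;> fin_cases b <;> simp [pattern321, Fin.rev, h1, h2, h3, h1.le, h2.le, h3.le]
  · rintro h ⟨f, hf, hσ⟩
    have h01 : f 0 < f 1 := hf (by decide)
    have h12 : f 1 < f 2 := hf (by decide)
    refine h (f 0) (f 1) (f 2) h01 h12 (f 2).2 ?_ ?_
    · simp only [seq, Fin.is_lt, dite_true, Fin.eta]
      exact (hσ 1 2).2 (by decide)
    · simp only [seq, Fin.is_lt, dite_true, Fin.eta]
      exact (hσ 0 1).2 (by decide)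

lemma seq_mul_swap (σ : Equiv.Perm (Fin n)) {p : ℕ} (hp : p + 1 < n) (i : ℕ) :
    seq (σ * Equiv.swap ⟨p, by omega⟩ ⟨p + 1, hp⟩) i =
      if i = p then seq σ (p + 1) else if i = p + 1 then seq σ p else seq σ i := by
  have hp' : p < n := by omega
  by_cases h : i < n
  · simp only [seq, h, hp, hp', dite_true, Equiv.Perm.mul_apply, Equiv.swap_apply_def, Fin.mk.injEq]
    split_ifs <;> rfl
  · have h1 : i ≠ p := by omega
    have h2 : i ≠ p + 1 := by omega
    simp [seq, h, h1, h2]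

end seq

/-! ### Sparse sets and the possible descent sets. -/

/-- The `321`-avoiding permutations of length `n` with descent set `D`. -/
noncomputable def avoidersDes (n : ℕ) (D : Finset ℕ) : Finset (Equiv.Perm (Fin n)) :=
  {σ ∈ avoiders pattern321 n | desSet σ = D}

/-- The set `{1, 3, …, 2k - 1, 2k + 2, 2k + 4, …, 2m}`. -/
def sparseSet (m k : ℕ) : Finset ℕ :=
  (Finset.range m).image fun i => if i < k then 2 * i + 1 else 2 * i + 2

lemma mem_sparseSet {m k j : ℕ} :
    j ∈ sparseSet m k ↔ ∃ i < m, (if i < k then 2 * i + 1 else 2 * i + 2) = j := by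
  simp [sparseSet]

lemma mem_sparseSet_iff {m k j : ℕ} (hk : k ≤ m) :
    j ∈ sparseSet m k ↔ (j < 2 * k ∧ j % 2 = 1) ∨ (2 * k < j ∧ j ≤ 2 * m ∧ j % 2 = 0) := by
  rw [mem_sparseSet]
  constructor
  · rintro ⟨i, hi, rfl⟩
    split_ifs <;> omega
  · intro h
    refine ⟨(j - 1) / 2, by omega, ?_⟩
    split_ifs <;> omega

lemma injOn_sparseSet (m k : ℕ) :
    Set.InjOn (fun i => if i < k then 2 * i + 1 else 2 * i + 2) (Finset.range m : Set ℕ) := by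
  intro i _ j _ h
  dsimp only at h
  split_ifs at h <;> omega

lemma card_sparseSet (m k : ℕ) : (sparseSet m k).card = m := by
  rw [sparseSet, Finset.card_image_of_injOn (injOn_sparseSet m k), Finset.card_range]

lemma sum_sparseSet {m k : ℕ} (hk : k ≤ m) : ∑ i ∈ sparseSet m k, i = m ^ 2 + (m - k) := by
  rw [sparseSet, Finset.sum_image (injOn_sparseSet m k)]
  obtain ⟨d, rfl⟩ := Nat.exists_eq_add_of_le hk
  rw [Nat.add_sub_cancel_left, Finset.sum_range_add]
  have h1 : ∑ i ∈ Finset.range k, (if i < k then 2 * i + 1 else 2 * i + 2) = k ^ 2 := by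
    rw [Finset.sum_congr rfl (g := fun i => 2 * i + 1)
      (fun i hi => by simp [Finset.mem_range.1 hi])]
    clear hk
    induction k with
    | zero => simp
    | succ k ih => rw [Finset.sum_range_succ, ih]; ring
  rw [h1]
  have h2 : ∑ i ∈ Finset.range d, (if k + i < k then 2 * (k + i) + 1 else 2 * (k + i) + 2) =
      d ^ 2 + d + 2 * k * d := by
    clear hk h1
    induction d with
    | zero => simp
    | succ d ih => rw [Finset.sum_range_succ, ih]; simp; ring
  rw [h2]; ring

lemma card_le_of_sparse {D : Finset ℕ} {r : ℕ} (hD : D ⊆ Finset.Icc 1 r)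
    (hs : ∀ i ∈ D, i + 1 ∉ D) : D.card ≤ (r + 1) / 2 := by
  have : D.card ≤ (Finset.range ((r + 1) / 2)).card := by
    -- This sends i to the index of its pair {1,2}, {3,4}, …; a sparse set meets each pair at most
    -- once.
    refine Finset.card_le_card_of_injOn (fun i => (i - 1) / 2) ?_ ?_
    · intro i hi
      have := Finset.mem_Icc.1 (hD hi)
      simp only [Finset.coe_range, Set.mem_Iio]
      omega
    · intro i hi j hj h
      have h1 := Finset.mem_Icc.1 (hD hi)
      have h2 := Finset.mem_Icc.1 (hD hj)
      dsimp only at h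
      rcases lt_trichotomy i j with hlt | rfl | hlt
      · exact absurd hj (by rw [show j = i + 1 by omega]; exact hs i hi)
      · rfl
      · exact absurd hi (by rw [show i = j + 1 by omega]; exact hs j hj)
  simpa using this

/-- Induction on the last pair. If 2m + 2 is in `D`, removing it leaves a set for m with the same k.
Otherwise counting forces 2m + 1 into `D`, which excludes 2m, so all the other elements are odd. -/
lemma exists_eq_sparseSet {m : ℕ} {D : Finset ℕ} (hD : D ⊆ Finset.Icc 1 (2 * m))
    (hs : ∀ i ∈ D, i + 1 ∉ D) (hc : D.card = m) : ∃ k ≤ m, D = sparseSet m k := by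
  induction m generalizing D with
  | zero => exact ⟨0, le_rfl, by simp_all [sparseSet]⟩
  | succ m ih =>
    have hbd : ∀ i ∈ D, 1 ≤ i ∧ i ≤ 2 * m + 2 := fun i hi => by
      have := Finset.mem_Icc.1 (hD hi); omega
    by_cases h : 2 * m + 2 ∈ D
    · obtain ⟨k, hk, hDk⟩ := ih (D := D.erase (2 * m + 2)) (fun i hi => by
        obtain ⟨hne, hi⟩ := Finset.mem_erase.1 hi
        have := hbd i hi
        have : i ≠ 2 * m + 1 := fun e => hs i hi (by rwa [e])
        rw [Finset.mem_Icc]; omega)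
        (fun i hi h' => hs i (Finset.mem_of_mem_erase hi) (Finset.mem_of_mem_erase h'))
        (by rw [Finset.card_erase_of_mem h, hc]; rfl)
      refine ⟨k, by omega, ?_⟩
      rw [← Finset.insert_erase h, hDk]
      ext j
      rw [Finset.mem_insert, mem_sparseSet_iff hk, mem_sparseSet_iff (by omega)]
      omega
    · have h1 : 2 * m + 1 ∈ D := by
        by_contra h1
        have := card_le_of_sparse (D := D) (r := 2 * m) (fun i hi => by
          have := hbd i hi
          have : i ≠ 2 * m + 1 := fun e => h1 (e ▸ hi)
          have : i ≠ 2 * m + 2 := fun e => h (e ▸ hi)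
          rw [Finset.mem_Icc]; omega) hs
        omega
      have h2 : ∀ i ∈ D.erase (2 * m + 1), 1 ≤ i ∧ i < 2 * m := fun i hi => by
        obtain ⟨hne, hi⟩ := Finset.mem_erase.1 hi
        have := hbd i hi
        have : i ≠ 2 * m + 2 := fun e => h (e ▸ hi)
        have : i ≠ 2 * m := fun e => hs i hi (by rwa [e])
        omega
      obtain ⟨k, hk, hDk⟩ := ih (D := D.erase (2 * m + 1)) (fun i hi => by
        have := h2 i hi
        rw [Finset.mem_Icc]; omega)
        (fun i hi h' => hs i (Finset.mem_of_mem_erase hi) (Finset.mem_of_mem_erase h'))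
        (by rw [Finset.card_erase_of_mem h1, hc]; rfl)
      -- If k < m, the largest element of `sparseSet m k` is 2m, which is adjacent to 2m + 1.
      have hkm : k = m := by
        by_contra hne
        have := h2 (2 * m) (by rw [hDk, mem_sparseSet_iff hk]; omega)
        omega
      subst hkm
      refine ⟨k + 1, le_rfl, ?_⟩
      rw [← Finset.insert_erase h1, hDk]
      ext j
      rw [Finset.mem_insert, mem_sparseSet_iff hk, mem_sparseSet_iff le_rfl]
      omega

lemma eq_sparseSet_self {m : ℕ} {D : Finset ℕ} (hD : D ⊆ Finset.Icc 1 (2 * m - 1))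
    (hs : ∀ i ∈ D, i + 1 ∉ D) (hc : D.card = m) : D = sparseSet m m := by
  obtain ⟨k, hk, rfl⟩ := exists_eq_sparseSet
    (hD.trans (Finset.Icc_subset_Icc_right (by omega))) hs hc
  by_contra hne
  have hlt : k < m := lt_of_le_of_ne hk (by rintro rfl; exact hne rfl)
  have := Finset.mem_Icc.1 (hD ((mem_sparseSet_iff hk (j := 2 * m)).2 (by omega)))
  omega

lemma desSet_subset {n : ℕ} (σ : Equiv.Perm (Fin n)) : desSet σ ⊆ Finset.Icc 1 (n - 1) := by
  intro i hi
  rw [mem_desSet] at hi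
  rw [Finset.mem_Icc]
  omega

lemma desSet_sparse {n : ℕ} {σ : Equiv.Perm (Fin n)} (h : Avoids pattern321 σ) :
    ∀ i ∈ desSet σ, i + 1 ∉ desSet σ := by
  intro i hi hi'
  rw [mem_desSet] at hi hi'
  exact avoids_iff.1 h (i - 1) i (i + 1) (by omega) (by omega) hi'.2.1 hi'.2.2 hi.2.2

lemma des_le {n : ℕ} {σ : Equiv.Perm (Fin n)} (h : Avoids pattern321 σ) : des σ ≤ n / 2 := by
  have := card_le_of_sparse (desSet_subset σ) (desSet_sparse h)
  rw [des]
  omega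

lemma mem_avoiders {n : ℕ} {σ : Equiv.Perm (Fin n)} :
    σ ∈ avoiders pattern321 n ↔ Avoids pattern321 σ := by
  simp [avoiders]

/-- Membership in `avoidersDes n D` in terms of the one-line notation. -/
lemma mem_avoidersDes {n : ℕ} {D : Finset ℕ} (hD : D ⊆ Finset.Icc 1 (n - 1))
    {σ : Equiv.Perm (Fin n)} :
    σ ∈ avoidersDes n D ↔
      (∀ i j l, i < j → j < l → l < n → seq σ l < seq σ j → seq σ j < seq σ i → False) ∧
      ∀ i, i + 1 < n → (seq σ (i + 1) < seq σ i ↔ i + 1 ∈ D) := by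
  rw [avoidersDes, Finset.mem_filter, mem_avoiders, avoids_iff, and_congr_right_iff]
  intro _
  constructor
  · rintro rfl i hi
    rw [mem_desSet]
    simp [hi]
  · intro h
    ext i
    rw [mem_desSet]
    constructor
    · rintro ⟨h1, h2, h3⟩
      have := h (i - 1)
      rw [Nat.sub_add_cancel h1] at this
      exact (this h2).1 h3
    · intro hi
      have hb := Finset.mem_Icc.1 (hD hi)
      have := h (i - 1)
      rw [Nat.sub_add_cancel hb.1] at this
      exact ⟨hb.1, by omega, (this (by omega)).2 hi⟩

/-! ### Knuth moves and independence of k. -/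

lemma avoid_of_swap {f f' : ℕ → ℕ} {n p : ℕ} (hp : p + 1 < n)
    (hf' : ∀ i, f' i = if i = p then f (p + 1) else if i = p + 1 then f p else f i)
    (h : ∀ i j l, i < j → j < l → l < n → f l < f j → f j < f i → False)
    (hl : ∀ x < p, f p < f (p + 1) → f (p + 1) < f x → False)
    (hr : ∀ y, p + 1 < y → y < n → f p < f (p + 1) → f y < f p → False) :
    ∀ i j l, i < j → j < l → l < n → f' l < f' j → f' j < f' i → False := by
  intro i j l hij hjl hln h1 h2
  have hi := hf' i
  have hj := hf' j
  have hl' := hf' l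
  -- A `321` using both swapped positions requires an ascent of `f` there, and its third entry is
  -- excluded by `hr` or `hl`. Any other `321` of `f'` is carried to one of `f`, since the swap
  -- keeps its positions in order.
  by_cases c1 : i = p ∧ j = p + 1
  · obtain ⟨rfl, rfl⟩ := c1
    have e1 : l ≠ i := by omega
    have e2 : l ≠ i + 1 := by omega
    simp [e1, e2] at hi hj hl'
    exact hr l hjl hln (by omega) (by omega)
  by_cases c2 : j = p ∧ l = p + 1
  · obtain ⟨rfl, rfl⟩ := c2
    have e1 : i ≠ j := by omega
    have e2 : i ≠ j + 1 := by omega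
    simp [e1, e2] at hi hj hl'
    exact hl i hij (by omega) (by omega)
  have key : ∀ x, f' x = f (if x = p then p + 1 else if x = p + 1 then p else x) := by
    intro x; rw [hf' x]; split_ifs <;> rfl
  rw [key l, key j] at h1
  rw [key j, key i] at h2
  refine h _ _ _ ?_ ?_ ?_ h1 h2 <;> split_ifs <;> omega

lemma sparseSet_subset {m k : ℕ} (hk : k ≤ m) : sparseSet m k ⊆ Finset.Icc 1 (2 * m) := by
  intro i hi
  rw [mem_sparseSet_iff hk] at hi
  rw [Finset.mem_Icc]
  omega

lemma mem_avoidersDes_sparseSet {m k : ℕ} (hk : k ≤ m) {σ : Equiv.Perm (Fin (2 * m + 1))} :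
    σ ∈ avoidersDes (2 * m + 1) (sparseSet m k) ↔
      (∀ i j l, i < j → j < l → l < 2 * m + 1 →
        seq σ l < seq σ j → seq σ j < seq σ i → False) ∧
      ∀ i, i < 2 * m → (seq σ (i + 1) < seq σ i ↔
        (i < 2 * k ∧ i % 2 = 0) ∨ (2 * k ≤ i ∧ i % 2 = 1)) := by
  rw [mem_avoidersDes (by simpa using sparseSet_subset hk), and_congr_right_iff]
  intro _
  refine forall_congr' fun i => ⟨fun h hi => ?_, fun h hi => ?_⟩
  · rw [h (by omega), mem_sparseSet_iff hk]; omega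
  · rw [h (by omega), mem_sparseSet_iff hk]; omega

/-- Changing the three entries at `2k`, `2k + 1`, `2k + 2` of a sequence with descents prescribed
by `k` yields a sequence with descents prescribed by `k'`. -/
lemma des_of_local_change {f f' : ℕ → ℕ} {m k k' l : ℕ} (hl : l < m)
    (hk : k = l ∨ k = l + 1) (hk' : k' = l ∨ k' = l + 1)
    (hdes : ∀ i, i < 2 * m → (f (i + 1) < f i ↔
      (i < 2 * k ∧ i % 2 = 0) ∨ (2 * k ≤ i ∧ i % 2 = 1)))
    (heq : ∀ i, i < 2 * l ∨ 2 * l + 2 < i → f' i = f i)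
    (hleft : ∀ i, i + 1 = 2 * l → f i ≤ f' (2 * l))
    (h0 : f' (2 * l + 1) < f' (2 * l) ↔ k' = l + 1)
    (h1 : f' (2 * l + 2) < f' (2 * l + 1) ↔ k' = l)
    (hright : 2 * l + 2 < 2 * m → f' (2 * l + 2) ≤ f (2 * l + 3)) :
    ∀ i, i < 2 * m → (f' (i + 1) < f' i ↔
      (i < 2 * k' ∧ i % 2 = 0) ∨ (2 * k' ≤ i ∧ i % 2 = 1)) := by
  intro i hi
  have h2 := hdes i hi
  rcases lt_or_ge (i + 1) (2 * l) with c | c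
  · rw [heq i (by omega), heq (i + 1) (by omega)]; omega
  rcases lt_or_ge (2 * l + 2) i with c' | c'
  · rw [heq i (by omega), heq (i + 1) (by omega)]; omega
  obtain c | rfl | rfl | rfl :
      i + 1 = 2 * l ∨ i = 2 * l ∨ i = 2 * l + 1 ∨ i = 2 * l + 2 := by omega
  · have := hleft i c
    rw [c, heq i (by omega)]; omega
  · omega
  · change f' (2 * l + 2) < f' (2 * l + 1) ↔ _
    omega
  · change f' (2 * l + 3) < f' (2 * l + 2) ↔ _
    have := hright hi
    rw [heq (2 * l + 3) (by omega)]; omega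

/-- An elementary Knuth move on the entries at `2k`, `2k + 1`, `2k + 2` that exchanges the
patterns `231`, `132` with the patterns `213`, `312`. -/
noncomputable def knuthMove {m k : ℕ} (hk : k < m) (c : Prop) [Decidable c]
    (σ : Equiv.Perm (Fin (2 * m + 1))) : Equiv.Perm (Fin (2 * m + 1)) :=
  if c then σ * Equiv.swap ⟨2 * k + 1, by omega⟩ ⟨2 * k + 2, by omega⟩
  else σ * Equiv.swap ⟨2 * k, by omega⟩ ⟨2 * k + 1, by omega⟩

section knuth

variable {m k : ℕ} (hk : k < m) {σ : Equiv.Perm (Fin (2 * m + 1))} {c : Prop} [Decidable c]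

lemma seq_knuthMove_pos (hc : c) (i : ℕ) : seq (knuthMove hk c σ) i =
    if i = 2 * k + 1 then seq σ (2 * k + 2) else
      if i = 2 * k + 2 then seq σ (2 * k + 1) else seq σ i := by
  rw [knuthMove, if_pos hc]
  exact seq_mul_swap σ (p := 2 * k + 1) (by omega) i

lemma seq_knuthMove_neg (hc : ¬ c) (i : ℕ) : seq (knuthMove hk c σ) i =
    if i = 2 * k then seq σ (2 * k + 1) else
      if i = 2 * k + 1 then seq σ (2 * k) else seq σ i := by
  rw [knuthMove, if_neg hc]
  exact seq_mul_swap σ (p := 2 * k) (by omega) i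

lemma knuthMove_knuthMove {c' : Prop} [Decidable c'] (h : c ↔ c') :
    knuthMove hk c (knuthMove hk c' σ) = σ := by
  by_cases hc : c
  · have hc' := h.1 hc
    simp [knuthMove, hc, hc', mul_assoc]
  · have hc' : ¬ c' := fun x => hc (h.2 x)
    simp [knuthMove, hc, hc', mul_assoc]

lemma knuthMove_mem_succ (hσ : σ ∈ avoidersDes (2 * m + 1) (sparseSet m k)) :
    knuthMove hk (seq σ (2 * k + 2) < seq σ (2 * k)) σ ∈
      avoidersDes (2 * m + 1) (sparseSet m (k + 1)) := by
  rw [mem_avoidersDes_sparseSet hk.le] at hσ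
  rw [mem_avoidersDes_sparseSet (by omega)]
  obtain ⟨hav, hdes⟩ := hσ
  have h0 := hdes (2 * k) (by omega)
  have h1 : seq σ (2 * k + 2) < seq σ (2 * k + 1) ↔ _ := hdes (2 * k + 1) (by omega)
  have h3 : 2 * k + 2 < 2 * m → (seq σ (2 * k + 3) < seq σ (2 * k + 2) ↔ _) :=
    hdes (2 * k + 2)
  have h4 : 2 * k + 3 < 2 * m → (seq σ (2 * k + 4) < seq σ (2 * k + 3) ↔ _) :=
    hdes (2 * k + 3)
  have h5 : ∀ i, i + 1 = 2 * k → seq σ i ≤ seq σ (2 * k) := fun i hi => by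
    have := hdes i (by omega)
    rw [hi] at this; omega
  have hne : seq σ (2 * k) ≠ seq σ (2 * k + 1) := fun e => by
    have := seq_inj σ (by omega) (by omega) e; omega
  have hne' : seq σ (2 * k) ≠ seq σ (2 * k + 2) := fun e => by
    have := seq_inj σ (by omega) (by omega) e; omega
  by_cases hc : seq σ (2 * k + 2) < seq σ (2 * k)
  · have hs := seq_knuthMove_pos hk (σ := σ) hc
    -- Case 231 → 213. The old middle entry now precedes position 2k + 3. Were it larger than that
    -- entry, the descent from 2k + 3 to 2k + 4 would complete a `321` in `σ`.
    have h6 := hav (2 * k + 1) (2 * k + 3) (2 * k + 4) (by omega) (by omega)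
    refine ⟨avoid_of_swap (p := 2 * k + 1) (by omega) hs hav ?_ ?_,
      des_of_local_change hk (.inl rfl) (.inr rfl) hdes ?_ ?_ ?_ ?_ ?_⟩
    · intro x _ h; exact absurd h (by change ¬ (_ < seq σ (2 * k + 2)); omega)
    · intro x _ _ h; exact absurd h (by change ¬ (_ < seq σ (2 * k + 2)); omega)
    · intro i hi; rw [hs, if_neg (by omega), if_neg (by omega)]
    · intro i hi; rw [hs, if_neg (by omega), if_neg (by omega)]; exact h5 i hi
    · simp only [hs]; simp; omega
    · simp only [hs]; simp; omega
    · intro h; simp only [hs]; simp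
      by_contra h7
      exact h6 (by omega) (by omega) (by omega)
  · have hs := seq_knuthMove_neg hk (σ := σ) hc
    refine ⟨avoid_of_swap (p := 2 * k) (by omega) hs hav ?_ ?_,
      des_of_local_change hk (.inl rfl) (.inr rfl) hdes ?_ ?_ ?_ ?_ ?_⟩
    -- Case 132 → 312. A larger entry on the left, or an entry on the right smaller than the first
    -- of the three, already forms a `321` with the descent from 2k + 1 to 2k + 2.
    · intro x hx _ h
      exact hav x (2 * k + 1) (2 * k + 2) (by omega) (by omega) (by omega) (by omega) h
    · intro y hy hyn _ h
      have : y ≠ 2 * k + 2 := by rintro rfl; omega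
      exact hav (2 * k + 1) (2 * k + 2) y (by omega) (by omega) (by omega) (by omega) (by omega)
    · intro i hi; rw [hs, if_neg (by omega), if_neg (by omega)]
    · intro i hi; rw [hs, if_pos rfl]; have := h5 i hi; omega
    · simp only [hs]; simp; omega
    · simp only [hs]; simp; omega
    · intro h; simp only [hs]; simp; omega

lemma knuthMove_mem (hσ : σ ∈ avoidersDes (2 * m + 1) (sparseSet m (k + 1))) :
    knuthMove hk (seq σ (2 * k) < seq σ (2 * k + 2)) σ ∈
      avoidersDes (2 * m + 1) (sparseSet m k) := by
  rw [mem_avoidersDes_sparseSet (by omega)] at hσ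
  rw [mem_avoidersDes_sparseSet hk.le]
  obtain ⟨hav, hdes⟩ := hσ
  have h0 := hdes (2 * k) (by omega)
  have h1 : seq σ (2 * k + 2) < seq σ (2 * k + 1) ↔ _ := hdes (2 * k + 1) (by omega)
  have h3 : 2 * k + 2 < 2 * m → (seq σ (2 * k + 3) < seq σ (2 * k + 2) ↔ _) :=
    hdes (2 * k + 2)
  have h5 : ∀ i, i + 1 = 2 * k → seq σ i ≤ seq σ (2 * k) := fun i hi => by
    have := hdes i (by omega)
    rw [hi] at this; omega
  -- In the case 312 → 132 the old middle entry moves next to position 2k - 1. It cannot be smaller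
  -- than the entry there, because of the descent from 2k - 2 to 2k - 1.
  have h6 : ∀ i, i + 1 = 2 * k → seq σ i ≤ seq σ (2 * k + 1) := fun i hi => by
    by_contra h
    have h7 := hdes (i - 1) (by omega)
    rw [show i - 1 + 1 = i by omega] at h7
    exact hav (i - 1) i (2 * k + 1) (by omega) (by omega) (by omega) (by omega) (by omega)
  have hne : seq σ (2 * k + 1) ≠ seq σ (2 * k + 2) := fun e => by
    have := seq_inj σ (by omega) (by omega) e; omega
  have hne' : seq σ (2 * k) ≠ seq σ (2 * k + 2) := fun e => by
    have := seq_inj σ (by omega) (by omega) e; omega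
  by_cases hc : seq σ (2 * k) < seq σ (2 * k + 2)
  · have hs := seq_knuthMove_pos hk (σ := σ) hc
    refine ⟨avoid_of_swap (p := 2 * k + 1) (by omega) hs hav ?_ ?_,
      des_of_local_change hk (.inr rfl) (.inl rfl) hdes ?_ ?_ ?_ ?_ ?_⟩
    · intro x hx _ h
      change seq σ (2 * k + 2) < _ at h
      have : x ≠ 2 * k := by rintro rfl; omega
      exact hav x (2 * k) (2 * k + 1) (by omega) (by omega) (by omega) (by omega) (by omega)
    · intro y hy hyn _ h
      exact hav (2 * k) (2 * k + 1) y (by omega) (by omega) (by omega) (by omega) (by omega)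
    · intro i hi; rw [hs, if_neg (by omega), if_neg (by omega)]
    · intro i hi; rw [hs, if_neg (by omega), if_neg (by omega)]; exact h5 i hi
    · simp only [hs]; simp; omega
    · simp only [hs]; simp; omega
    · intro h; simp only [hs]; simp; omega
  · have hs := seq_knuthMove_neg hk (σ := σ) hc
    refine ⟨avoid_of_swap (p := 2 * k) (by omega) hs hav ?_ ?_,
      des_of_local_change hk (.inr rfl) (.inl rfl) hdes ?_ ?_ ?_ ?_ ?_⟩
    · intro x _ h; omega
    · intro x _ _ h; omega
    · intro i hi; rw [hs, if_neg (by omega), if_neg (by omega)]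
    · intro i hi; rw [hs, if_pos rfl]; exact h6 i hi
    · simp only [hs]; simp; omega
    · simp only [hs]; simp; omega
    · intro h; simp only [hs]; simp; omega

end knuth

/-- Each move reverses the comparison of the two outer entries, and the tests of the two maps are
opposite. Both maps therefore choose the same transposition, and they are mutually inverse. -/
lemma card_avoidersDes_succ {m k : ℕ} (hk : k < m) :
    (avoidersDes (2 * m + 1) (sparseSet m k)).card =
      (avoidersDes (2 * m + 1) (sparseSet m (k + 1))).card := by
  refine Finset.card_bij'
    (fun σ _ => knuthMove hk (seq σ (2 * k + 2) < seq σ (2 * k)) σ)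
    (fun σ _ => knuthMove hk (seq σ (2 * k) < seq σ (2 * k + 2)) σ)
    (fun σ hσ => knuthMove_mem_succ hk hσ) (fun σ hσ => knuthMove_mem hk hσ) ?_ ?_
  · intro σ hσ
    apply knuthMove_knuthMove
    have h1 := ((mem_avoidersDes_sparseSet hk.le).1 hσ).2
    have h0 := h1 (2 * k) (by omega)
    have hne : seq σ (2 * k) ≠ seq σ (2 * k + 1) := fun e => by
      have := seq_inj σ (by omega) (by omega) e; omega
    have hne' : seq σ (2 * k + 1) ≠ seq σ (2 * k + 2) := fun e => by
      have := seq_inj σ (by omega) (by omega) e; omega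
    have h1 : seq σ (2 * k + 2) < seq σ (2 * k + 1) ↔ _ := h1 (2 * k + 1) (by omega)
    by_cases hc : seq σ (2 * k + 2) < seq σ (2 * k)
    · simp only [seq_knuthMove_pos hk hc]; simp; omega
    · simp only [seq_knuthMove_neg hk hc]; simp; omega
  · intro σ hσ
    apply knuthMove_knuthMove
    have h1 := ((mem_avoidersDes_sparseSet (by omega)).1 hσ).2
    have h0 := h1 (2 * k) (by omega)
    have hne : seq σ (2 * k) ≠ seq σ (2 * k + 1) := fun e => by
      have := seq_inj σ (by omega) (by omega) e; omega
    have hne' : seq σ (2 * k + 1) ≠ seq σ (2 * k + 2) := fun e => by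
      have := seq_inj σ (by omega) (by omega) e; omega
    have h1 : seq σ (2 * k + 2) < seq σ (2 * k + 1) ↔ _ := h1 (2 * k + 1) (by omega)
    by_cases hc : seq σ (2 * k) < seq σ (2 * k + 2)
    · simp only [seq_knuthMove_pos hk hc]; simp; omega
    · simp only [seq_knuthMove_neg hk hc]; simp; omega

lemma card_avoidersDes_eq {m k : ℕ} (hk : k ≤ m) :
    (avoidersDes (2 * m + 1) (sparseSet m k)).card =
      (avoidersDes (2 * m + 1) (sparseSet m m)).card := by
  induction hk using Nat.decreasingInduction with
  | self => rfl
  | of_succ k hk ih => rw [card_avoidersDes_succ hk, ih]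

/-! ### From odd length to even length. -/

lemma mem_avoidersDes_even {m : ℕ} {σ : Equiv.Perm (Fin (2 * m))} :
    σ ∈ avoidersDes (2 * m) (sparseSet m m) ↔
      (∀ i j l, i < j → j < l → l < 2 * m → seq σ l < seq σ j → seq σ j < seq σ i → False) ∧
      ∀ i, i + 1 < 2 * m → (seq σ (i + 1) < seq σ i ↔ i % 2 = 0) := by
  rw [mem_avoidersDes, and_congr_right_iff]
  · intro _
    refine forall_congr' fun i => forall_congr' fun hi => ?_
    rw [mem_sparseSet_iff le_rfl]
    omega
  · intro i hi
    rw [mem_sparseSet_iff le_rfl] at hi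
    rw [Finset.mem_Icc]
    omega

/-- Inserting the largest letter before the last entry. -/
lemma card_avoidersDes_insert_max (m : ℕ) :
    (avoidersDes (2 * m + 1) (sparseSet m m)).card =
      (avoidersDes (2 * (m + 1)) (sparseSet (m + 1) (m + 1))).card := by
  have hex : ∀ σ : Equiv.Perm (Fin (2 * m + 1)), ∃ τ : Equiv.Perm (Fin (2 * (m + 1))),
      ∀ i < 2 * (m + 1), seq τ i =
        if i = 2 * m then 2 * m + 1 else if i = 2 * m + 1 then seq σ (2 * m) else seq σ i := by
    intro σ
    have hlt := fun i => seq_lt σ (i := i)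
    refine exists_perm_of_injOn _ (fun i hi => ?_) (fun i hi j hj h => ?_)
    · have h1 := hlt i
      have h2 := hlt (2 * m)
      split_ifs <;> omega
    · have h1 := hlt i
      have h2 := hlt j
      have h3 := hlt (2 * m)
      have h4 := fun a b => seq_inj σ (i := i) (j := j) a b
      have h5 := fun a b => seq_inj σ (i := 2 * m) (j := j) a b
      have h6 := fun a b => seq_inj σ (i := i) (j := 2 * m) a b
      split_ifs at h <;> grind
  choose F hF using hex
  refine Finset.card_bij (fun σ _ => F σ) (fun σ hσ => ?_) (fun σ _ σ' _ h => ?_)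
    (fun τ hτ => ?_)
  · obtain ⟨hav, hdes⟩ := (mem_avoidersDes_sparseSet le_rfl).1 hσ
    refine mem_avoidersDes_even.2 ⟨fun i j l hij hjl hl h1 h2 => ?_, fun i hi => ?_⟩
    · rw [hF σ l hl, hF σ j (by omega)] at h1
      rw [hF σ j (by omega), hF σ i (by omega)] at h2
      have a := seq_lt σ (i := i)
      have b := seq_lt σ (i := j)
      have hi : i ≠ 2 * m := by omega
      have hi' : i ≠ 2 * m + 1 := by omega
      have hj : j ≠ 2 * m := by
        rintro rfl
        simp [hi, hi'] at h2; omega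
      have hj' : j ≠ 2 * m + 1 := by omega
      have hl' : l ≠ 2 * m := by
        rintro rfl
        simp [hj, hj'] at h1; omega
      simp only [hi, hi', hj, hj', hl', if_false] at h1 h2
      split_ifs at h1 with c
      · exact hav i j (2 * m) hij (by omega) (by omega) h1 h2
      · exact hav i j l hij hjl (by omega) h1 h2
    · rw [hF σ i (by omega), hF σ (i + 1) hi]
      have a := seq_lt σ (i := i)
      have b := seq_lt σ (i := 2 * m)
      have c := hdes i
      split_ifs <;> omega
  · refine perm_ext fun i hi => ?_
    rcases eq_or_ne i (2 * m) with rfl | hne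
    · have h1 := hF σ (2 * m + 1) (by omega)
      have h2 := hF σ' (2 * m + 1) (by omega)
      rw [h] at h1
      simp at h1 h2
      omega
    · have h1 := hF σ i (by omega)
      have h2 := hF σ' i (by omega)
      rw [h] at h1
      have : i ≠ 2 * m + 1 := by omega
      simp [hne, this] at h1 h2
      omega
  · obtain ⟨hav, hdes⟩ := mem_avoidersDes_even.1 hτ
    -- An earlier maximum would form a `321` with the final descent, and a maximum in the last
    -- position would contradict that descent.
    have hmax : seq τ (2 * m) = 2 * m + 1 := by
      obtain ⟨x, hx, hxv⟩ := exists_seq_eq τ (v := 2 * m + 1) (by omega)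
      have hd := hdes (2 * m) (by omega)
      have hlt := seq_lt τ (i := 2 * m) (by omega)
      rcases lt_trichotomy x (2 * m) with h | rfl | h
      · have hne : seq τ (2 * m) ≠ seq τ x := fun e => by
          have := seq_inj τ (by omega) (by omega) e; omega
        exact (hav x (2 * m) (2 * m + 1) h (by omega) (by omega) (by omega) (by omega)).elim
      · exact hxv
      · obtain rfl : x = 2 * m + 1 := by omega
        omega
    have hlt : ∀ i < 2 * (m + 1), i ≠ 2 * m → seq τ i < 2 * m + 1 := fun i hi hne => by
      have := seq_lt τ hi
      have : seq τ i ≠ seq τ (2 * m) := fun e => hne (seq_inj τ hi (by omega) e)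
      omega
    obtain ⟨σ, hσ⟩ := exists_perm_of_injOn (n := 2 * m + 1)
      (fun i => seq τ (if i = 2 * m then 2 * m + 1 else i))
      (fun i hi => by
        apply hlt <;> split_ifs <;> omega)
      (fun i hi j hj h => by
        have := seq_inj τ (by split_ifs <;> omega) (by split_ifs <;> omega) h
        split_ifs at this <;> omega)
    refine ⟨σ, (mem_avoidersDes_sparseSet le_rfl).2 ⟨fun i j l hij hjl hl h1 h2 => ?_,
      fun i hi => ?_⟩, perm_ext fun i hi => ?_⟩
    · rw [hσ l hl, hσ j (by omega)] at h1
      rw [hσ j (by omega), hσ i (by omega)] at h2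
      refine hav _ _ _ ?_ ?_ ?_ h1 h2 <;> split_ifs <;> omega
    · rw [hσ i (by omega), hσ (i + 1) (by omega), if_neg (show i ≠ 2 * m by omega)]
      have h0 := hdes i (by omega)
      split_ifs with c
      -- Here i = 2m - 1. Deleting the maximum creates no descent before the last entry, since the
      -- descent into position i would extend to a `321`.
      · have h1 := hdes (i - 1) (by omega)
        rw [show i - 1 + 1 = i by omega] at h1
        have h2 := hav (i - 1) i (2 * m + 1) (by omega) (by omega) (by omega)
        have : ¬ seq τ (2 * m + 1) < seq τ i := fun h => h2 h (by omega)
        omega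
      · omega
    · rw [hF σ i hi]
      split_ifs with c1 c2
      · rw [c1, hmax]
      · rw [hσ _ (by omega), if_pos rfl, c2]
      · rw [hσ _ (by omega), if_neg c1]

/-! ### Prefix counts and increasing enumerations. -/

lemma count_take_eq_natCount {α : Type*} [DecidableEq α] (l : List α) (x : α) (v : ℕ) :
    (l.take v).count x = Nat.count (fun w => l[w]? = some x) v := by
  induction v with
  | zero => simp
  | succ v ih =>
    rw [List.take_add_one, List.count_append, ih, Nat.count_succ]
    congr 1
    rcases l[v]? with _ | y
    · simp
    · simp [List.count_singleton]

section enumeration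

variable {a : ℕ → ℕ} {m : ℕ} {P : ℕ → Prop} [DecidablePred P]

lemma count_eq_card_of_enum (ha : ∀ i j, i < j → j < m → a i < a j)
    (hP : ∀ v, P v ↔ ∃ i < m, a i = v) (v : ℕ) :
    Nat.count P v = ((Finset.range m).filter fun i => a i < v).card := by
  rw [Nat.count_eq_card_filter_range]
  rw [← Finset.card_image_of_injOn (s := (Finset.range m).filter fun i => a i < v) (f := a)]
  · congr 1
    ext w
    simp only [Finset.mem_filter, Finset.mem_range, hP, Finset.mem_image]
    constructor
    · rintro ⟨hw, i, hi, rfl⟩; exact ⟨i, ⟨hi, hw⟩, rfl⟩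
    · rintro ⟨i, ⟨hi, hw⟩, rfl⟩; exact ⟨hw, i, hi, rfl⟩
  · intro i hi j hj h
    simp only [Finset.coe_filter, Finset.mem_range, Set.mem_ofPred_eq] at hi hj
    rcases lt_trichotomy i j with c | c | c
    · have := ha i j c hj.1; omega
    · exact c
    · have := ha j i c hi.1; omega

lemma nth_eq_of_enum (ha : ∀ i j, i < j → j < m → a i < a j)
    (hP : ∀ v, P v ↔ ∃ i < m, a i = v) {i : ℕ} (hi : i < m) : Nat.nth P i = a i := by
  have hc : Nat.count P (a i) = i := by
    rw [count_eq_card_of_enum ha hP]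
    have : ((Finset.range m).filter fun j => a j < a i) = Finset.range i := by
      ext j
      simp only [Finset.mem_filter, Finset.mem_range]
      constructor
      · rintro ⟨hj, h⟩
        by_contra hij
        rcases eq_or_lt_of_le (not_lt.1 hij) with rfl | c
        · omega
        · have := ha i j c hj; omega
      · intro h; exact ⟨by omega, ha j i h hi⟩
    rw [this, Finset.card_range]
  conv_lhs => rw [← hc]
  exact Nat.nth_count ((hP _).2 ⟨i, hi, rfl⟩)

end enumeration

section nth

variable {P : ℕ → Prop} [DecidablePred P] {N i j : ℕ}

/-- Supplies the side condition of the `Nat.nth` lemmas when the predicate has finitely many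
solutions. -/
lemma lt_card_of_lt_count (hi : i < Nat.count P N) (hf : (Set.ofPred P).Finite) :
    i < hf.toFinset.card :=
  hi.trans_le (Nat.count_le_card hf N)

lemma nth_mem_of_lt_count (hi : i < Nat.count P N) : P (Nat.nth P i) :=
  Nat.nth_mem i (lt_card_of_lt_count hi)

lemma nth_lt_nth_of_lt_count (hij : i < j) (hj : j < Nat.count P N) :
    Nat.nth P i < Nat.nth P j :=
  Nat.nth_lt_nth' hij (lt_card_of_lt_count hj)

lemma count_nth_of_lt_count (hi : i < Nat.count P N) : Nat.count P (Nat.nth P i) = i :=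
  Nat.count_nth (lt_card_of_lt_count hi)

lemma count_nth_succ_of_lt_count (hi : i < Nat.count P N) :
    Nat.count P (Nat.nth P i + 1) = i + 1 :=
  Nat.count_nth_succ (lt_card_of_lt_count hi)

end nth

/-! ### Two-row tableaux and ballot sequences. -/

/-- The `321`-avoiders of length `2m` with descents exactly at the odd positions are the
standard Young tableaux with two rows of length `m`. -/
lemma mem_avoidersDes_even_iff_tableau {m : ℕ} {σ : Equiv.Perm (Fin (2 * m))} :
    σ ∈ avoidersDes (2 * m) (sparseSet m m) ↔
      (∀ i < m, seq σ (2 * i + 1) < seq σ (2 * i)) ∧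
      (∀ i j, i < j → j < m → seq σ (2 * i) < seq σ (2 * j)) ∧
      (∀ i j, i < j → j < m → seq σ (2 * i + 1) < seq σ (2 * j + 1)) := by
  rw [mem_avoidersDes_even]
  constructor
  · rintro ⟨hav, hdes⟩
    have hd : ∀ i < m, seq σ (2 * i + 1) < seq σ (2 * i) := fun i hi =>
      (hdes (2 * i) (by omega)).2 (by omega)
    refine ⟨hd, fun i j hij hj => ?_, fun i j hij hj => ?_⟩
    · by_contra h
      have hne : seq σ (2 * i) ≠ seq σ (2 * j) := fun e => by
        have := seq_inj σ (by omega) (by omega) e; omega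
      exact hav (2 * i) (2 * j) (2 * j + 1) (by omega) (by omega) (by omega) (hd j hj) (by omega)
    · by_contra h
      have hne : seq σ (2 * i + 1) ≠ seq σ (2 * j + 1) := fun e => by
        have := seq_inj σ (by omega) (by omega) e; omega
      exact hav (2 * i) (2 * i + 1) (2 * j + 1) (by omega) (by omega) (by omega) (by omega)
        (hd i (by omega))
  · rintro ⟨hd, ht, hb⟩
    have hpar : ∀ x y, x < y → y < 2 * m → x % 2 = y % 2 → seq σ x < seq σ y := by
      intro x y hxy hy hp
      rcases Nat.mod_two_eq_zero_or_one x with h | h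
      · have := ht (x / 2) (y / 2) (by omega) (by omega)
        rwa [show 2 * (x / 2) = x by omega, show 2 * (y / 2) = y by omega] at this
      · have := hb (x / 2) (y / 2) (by omega) (by omega)
        rwa [show 2 * (x / 2) + 1 = x by omega, show 2 * (y / 2) + 1 = y by omega] at this
    refine ⟨fun i j l hij hjl hl h1 h2 => ?_, fun i hi => ?_⟩
    -- Two of three positions have the same parity, and entries at positions of the same parity
    -- increase.
    · have h3 := hpar i j hij (by omega)
      have h4 := hpar j l hjl hl
      have h5 := hpar i l (by omega) hl
      omega
    · rcases Nat.mod_two_eq_zero_or_one i with h | h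
      · have := hd (i / 2) (by omega)
        rw [show 2 * (i / 2) = i by omega] at this
        simp [this, h]
      · have h1 := hd (i / 2) (by omega)
        rw [show 2 * (i / 2) = i - 1 by omega, show i - 1 + 1 = i by omega] at h1
        have := hpar (i - 1) (i + 1) (by omega) hi (by omega)
        omega

/-- The permutation whose bottom row lists the solutions of `P` and whose top row lists the
solutions of `Q`. -/
lemma exists_perm_of_ballot {m : ℕ} {P Q : ℕ → Prop} [DecidablePred P] [DecidablePred Q]
    (hP : Nat.count P (2 * m) = m) (hQ : Nat.count Q (2 * m) = m)
    (hle : ∀ v, Nat.count Q v ≤ Nat.count P v) (hne : ∀ v, P v → ¬ Q v) :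
    ∃ σ : Equiv.Perm (Fin (2 * m)), σ ∈ avoidersDes (2 * m) (sparseSet m m) ∧
      ∀ i < m, seq σ (2 * i + 1) = Nat.nth P i ∧ seq σ (2 * i) = Nat.nth Q i := by
  have hltP : ∀ i < m, i < Nat.count P (2 * m) := fun i hi => hi.trans_eq hP.symm
  have hltQ : ∀ i < m, i < Nat.count Q (2 * m) := fun i hi => hi.trans_eq hQ.symm
  -- The prefix ending at solution i of `Q` holds at least i + 1 solutions of `P`, and disjointness
  -- makes the inequality strict.
  have hlt : ∀ i < m, Nat.nth P i < Nat.nth Q i := fun i hi => by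
    have h := hle (Nat.nth Q i + 1)
    rw [count_nth_succ_of_lt_count (hltQ i hi)] at h
    have h1 := Nat.nth_lt_of_lt_count h
    have h2 : Nat.nth P i ≠ Nat.nth Q i := fun e =>
      hne _ (nth_mem_of_lt_count (hltP i hi)) (e ▸ nth_mem_of_lt_count (hltQ i hi))
    omega
  obtain ⟨σ, hσ⟩ := exists_perm_of_injOn (n := 2 * m)
    (fun x => if x % 2 = 1 then Nat.nth P (x / 2) else Nat.nth Q (x / 2))
    (fun x hx => by
      split_ifs
      · exact Nat.nth_lt_of_lt_count (hltP _ (by omega))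
      · exact Nat.nth_lt_of_lt_count (hltQ _ (by omega)))
    (fun x hx y hy h => by
      have hxP := hltP (x / 2) (by omega)
      have hxQ := hltQ (x / 2) (by omega)
      have hyP := hltP (y / 2) (by omega)
      have hyQ := hltQ (y / 2) (by omega)
      split_ifs at h with c1 c2 c2
      · have h1 := count_nth_of_lt_count hxP
        rw [h, count_nth_of_lt_count hyP] at h1; omega
      · exact (hne _ (nth_mem_of_lt_count hxP) (h ▸ nth_mem_of_lt_count hyQ)).elim
      · exact (hne _ (nth_mem_of_lt_count hyP) (h ▸ nth_mem_of_lt_count hxQ)).elim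
      · have h1 := count_nth_of_lt_count hxQ
        rw [h, count_nth_of_lt_count hyQ] at h1; omega)
  have hb : ∀ i < m, seq σ (2 * i + 1) = Nat.nth P i := fun i hi => by
    rw [hσ _ (by omega), if_pos (by omega), show (2 * i + 1) / 2 = i by omega]
  have ht : ∀ i < m, seq σ (2 * i) = Nat.nth Q i := fun i hi => by
    rw [hσ _ (by omega), if_neg (by omega), show (2 * i) / 2 = i by omega]
  refine ⟨σ, mem_avoidersDes_even_iff_tableau.2 ⟨fun i hi => ?_, fun i j hij hj => ?_,
    fun i j hij hj => ?_⟩, fun i hi => ⟨hb i hi, ht i hi⟩⟩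
  · rw [hb i hi, ht i hi]; exact hlt i hi
  · rw [ht i (by omega), ht j hj]; exact nth_lt_nth_of_lt_count hij (hltQ j hj)
  · rw [hb i (by omega), hb j hj]; exact nth_lt_nth_of_lt_count hij (hltP j hj)

/-! ### Dyck words. -/

section dyck

variable {m : ℕ} {p : DyckWord}

lemma natCount_dyckWord (hp : p.semilength = m) (x : DyckStep) :
    Nat.count (fun v => p.toList[v]? = some x) (2 * m) = m := by
  rw [← count_take_eq_natCount, ← hp, p.two_mul_semilength_eq_length, List.take_length]
  cases x
  · rfl
  · exact p.semilength_eq_count_D.symm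

lemma exists_nth_eq_of_getElem? (hp : p.semilength = m) {x : DyckStep} {v : ℕ}
    (h : p.toList[v]? = some x) :
    ∃ i < m, Nat.nth (fun v => p.toList[v]? = some x) i = v := by
  have hlen := p.two_mul_semilength_eq_length
  rw [hp] at hlen
  have hv : v < 2 * m := by rw [hlen]; exact (List.getElem?_eq_some_iff.1 h).1
  refine ⟨Nat.count (fun v => p.toList[v]? = some x) v, ?_, Nat.nth_count h⟩
  have := Nat.count_strict_mono (p := fun v => p.toList[v]? = some x) h hv
  rwa [natCount_dyckWord hp] at this

lemma exists_perm_of_dyckWord (hp : p.semilength = m) :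
    ∃ σ : Equiv.Perm (Fin (2 * m)), σ ∈ avoidersDes (2 * m) (sparseSet m m) ∧
      ∀ i < m, seq σ (2 * i + 1) = Nat.nth (fun v => p.toList[v]? = some DyckStep.U) i ∧
        seq σ (2 * i) = Nat.nth (fun v => p.toList[v]? = some DyckStep.D) i := by
  refine exists_perm_of_ballot (natCount_dyckWord hp _) (natCount_dyckWord hp _) ?_ ?_
  · intro v
    rw [← count_take_eq_natCount, ← count_take_eq_natCount]
    exact p.count_D_le_count_U v
  · intro v h1 h2; rw [h1] at h2; simp at h2

lemma dyckWord_eq_of_nth {q : DyckWord} (hp : p.semilength = m) (hq : q.semilength = m)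
    (h : ∀ x, ∀ i < m, Nat.nth (fun v => p.toList[v]? = some x) i =
      Nat.nth (fun v => q.toList[v]? = some x) i) : p = q := by
  ext1
  refine List.ext_getElem? fun v => Option.ext fun x => ⟨fun hx => ?_, fun hx => ?_⟩
  · obtain ⟨i, hi, rfl⟩ := exists_nth_eq_of_getElem? hp hx
    rw [h x i hi]
    exact nth_mem_of_lt_count (P := fun v => q.toList[v]? = some x)
      (hi.trans_eq (natCount_dyckWord hq x).symm)
  · obtain ⟨i, hi, rfl⟩ := exists_nth_eq_of_getElem? hq hx
    rw [← h x i hi]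
    exact nth_mem_of_lt_count (P := fun v => p.toList[v]? = some x)
      (hi.trans_eq (natCount_dyckWord hp x).symm)

/-- The letter at index v records the row containing the value v: `U` for odd positions, `D` for
even ones. The prefix condition holds because each value at position 2i is preceded by the smaller
value at 2i + 1. -/
lemma exists_dyckWord_of_mem {σ : Equiv.Perm (Fin (2 * m))}
    (hσ : σ ∈ avoidersDes (2 * m) (sparseSet m m)) :
    ∃ p : DyckWord, p.semilength = m ∧
      ∀ i < m, seq σ (2 * i + 1) = Nat.nth (fun v => p.toList[v]? = some DyckStep.U) i ∧
        seq σ (2 * i) = Nat.nth (fun v => p.toList[v]? = some DyckStep.D) i := by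
  classical
  obtain ⟨hd, ht, hb⟩ := mem_avoidersDes_even_iff_tableau.1 hσ
  set l : List DyckStep := (List.range (2 * m)).map fun v =>
    if ∃ i < m, seq σ (2 * i + 1) = v then DyckStep.U else DyckStep.D with hl
  have hlen : l.length = 2 * m := by simp [hl]
  have hU : ∀ v, l[v]? = some DyckStep.U ↔ ∃ i < m, seq σ (2 * i + 1) = v := by
    intro v
    constructor
    · intro h
      by_contra hc
      simp only [hl, List.getElem?_map, Option.map_eq_some_iff, List.getElem?_eq_some_iff] at h
      obtain ⟨w, ⟨hw, rfl⟩, h⟩ := h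
      simp only [List.getElem_range] at h
      rw [if_neg hc] at h
      exact absurd h (by decide)
    · intro h
      have hv : v < 2 * m := by
        obtain ⟨i, hi, rfl⟩ := h
        exact seq_lt σ (by omega)
      rw [hl, List.getElem?_map, List.getElem?_range hv, Option.map_some, if_pos h]
  have hD : ∀ v, l[v]? = some DyckStep.D ↔ ∃ i < m, seq σ (2 * i) = v := by
    intro v
    constructor
    · intro h
      have hv : v < 2 * m := by rw [← hlen]; exact (List.getElem?_eq_some_iff.1 h).1
      obtain ⟨x, hx, hxv⟩ := exists_seq_eq σ hv
      rcases Nat.mod_two_eq_zero_or_one x with c | c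
      · exact ⟨x / 2, by omega, by rw [show 2 * (x / 2) = x by omega, hxv]⟩
      · have := (hU v).2 ⟨x / 2, by omega, by rw [show 2 * (x / 2) + 1 = x by omega, hxv]⟩
        rw [h] at this
        simp at this
    · rintro ⟨i, hi, rfl⟩
      have hv : seq σ (2 * i) < 2 * m := seq_lt σ (by omega)
      rw [hl, List.getElem?_map, List.getElem?_range hv, Option.map_some, if_neg]
      rintro ⟨j, hj, h⟩
      have := seq_inj σ (by omega) (by omega) h
      omega
  have hcU := count_eq_card_of_enum hb hU
  have hcD := count_eq_card_of_enum ht hD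
  have hcm : ∀ ε < 2, ((Finset.range m).filter fun i => seq σ (2 * i + ε) < 2 * m).card = m := by
    intro ε hε
    rw [Finset.filter_true_of_mem, Finset.card_range]
    intro i hi
    rw [Finset.mem_range] at hi
    exact seq_lt σ (by omega)
  have hlU : l.count DyckStep.U = m := by
    rw [← List.take_length (l := l), hlen, count_take_eq_natCount, hcU]
    exact hcm 1 (by omega)
  have hlD : l.count DyckStep.D = m := by
    rw [← List.take_length (l := l), hlen, count_take_eq_natCount, hcD]
    exact hcm 0 (by omega)
  refine ⟨⟨l, by rw [hlU, hlD], fun v => ?_⟩, hlU, fun i hi =>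
    ⟨(nth_eq_of_enum hb hU hi).symm, (nth_eq_of_enum ht hD hi).symm⟩⟩
  rw [count_take_eq_natCount, count_take_eq_natCount, hcU, hcD]
  refine Finset.card_le_card fun i hi => ?_
  simp only [Finset.mem_filter, Finset.mem_range] at hi ⊢
  exact ⟨hi.1, (hd i hi.1).trans hi.2⟩

end dyck

lemma card_avoidersDes_even (m : ℕ) :
    (avoidersDes (2 * m) (sparseSet m m)).card = catalan m := by
  rw [← DyckWord.card_dyckWord_semilength_eq_catalan, ← Finset.card_univ]
  symm
  choose F hF hF' using
    fun p : {p : DyckWord // p.semilength = m} => exists_perm_of_dyckWord p.2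
  refine Finset.card_bij (fun p _ => F p) (fun p _ => hF p) (fun p _ q _ h => ?_)
    (fun σ hσ => ?_)
  · refine Subtype.ext (dyckWord_eq_of_nth p.2 q.2 fun x i hi => ?_)
    have h1 := hF' p i hi
    rw [h] at h1
    cases x
    · rw [← h1.1, (hF' q i hi).1]
    · rw [← h1.2, (hF' q i hi).2]
  · obtain ⟨p, hp, h⟩ := exists_dyckWord_of_mem hσ
    refine ⟨⟨p, hp⟩, Finset.mem_univ _, perm_ext fun x hx => ?_⟩
    have h1 := hF' ⟨p, hp⟩ (x / 2) (by omega)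
    have h2 := h (x / 2) (by omega)
    rcases Nat.mod_two_eq_zero_or_one x with c | c
    · rw [show 2 * (x / 2) = x by omega] at h1 h2
      exact h1.2.trans h2.2.symm
    · rw [show 2 * (x / 2) + 1 = x by omega] at h1 h2
      exact h1.1.trans h2.1.symm

lemma card_avoidersDes_odd {m k : ℕ} (hk : k ≤ m) :
    (avoidersDes (2 * m + 1) (sparseSet m k)).card = catalan (m + 1) := by
  rw [card_avoidersDes_eq hk, card_avoidersDes_insert_max, card_avoidersDes_even]

/-! ### Catalan numbers and the leading coefficients. -/

lemma catalan_pos (m : ℕ) : 0 < catalan m := by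
  rw [catalan_eq_centralBinom_div]
  exact Nat.div_pos (Nat.le_of_dvd (Nat.centralBinom_pos m) (Nat.succ_dvd_centralBinom m))
    (Nat.succ_pos m)

lemma catalan_succ_eq_div_mul (m : ℕ) :
    (catalan (m + 1) : ℚ) = (4 * m + 2) / (m + 2) * catalan m := by
  have h1 : ((m + 1 + 1 : ℕ) : ℚ) * catalan (m + 1) = (m + 1).centralBinom := by
    exact_mod_cast succ_mul_catalan_eq_centralBinom (m + 1)
  have h2 : ((m + 1 : ℕ) : ℚ) * catalan m = m.centralBinom := by
    exact_mod_cast succ_mul_catalan_eq_centralBinom m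
  have h3 : ((m + 1 : ℕ) : ℚ) * (m + 1).centralBinom = 2 * (2 * m + 1 : ℕ) * m.centralBinom := by
    exact_mod_cast Nat.succ_mul_centralBinom_succ m
  rw [← h1, ← h2] at h3
  push_cast at h3
  have hm : (m : ℚ) + 1 ≠ 0 := by positivity
  have hm2 : (m : ℚ) + 2 ≠ 0 := by positivity
  have h4 : ((m : ℚ) + 2) * catalan (m + 1) = (4 * m + 2) * catalan m :=
    mul_left_cancel₀ hm (by linear_combination h3)
  rw [div_mul_eq_mul_div, eq_div_iff hm2]
  linear_combination h4

lemma g_eq_sum {k : ℕ} (π : Equiv.Perm (Fin k)) (n i : ℕ) :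
    g π n i = ∑ σ ∈ avoiders π n with des σ = i, X ^ maj σ := by
  rw [g, F, finsetSum_coeff, Finset.sum_filter]
  refine Finset.sum_congr rfl fun σ _ => ?_
  rw [coeff_C_mul_X_pow]
  simp only [eq_comm]

/-- If the descent sets of size `i` that occur are the `D k` for `k ∈ s`, then `g` is a sum over
`s`. -/
lemma g_eq_sum_card {n i : ℕ} (s : Finset ℕ) (D : ℕ → Finset ℕ) (hD : Set.InjOn D s)
    (hcard : ∀ k ∈ s, (D k).card = i)
    (hex : ∀ σ : Equiv.Perm (Fin n), Avoids pattern321 σ → des σ = i → ∃ k ∈ s, desSet σ = D k) :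
    g pattern321 n i =
      ∑ k ∈ s, ((avoidersDes n (D k)).card : ℚ[X]) * X ^ (∑ j ∈ D k, j) := by
  rw [g_eq_sum, ← Finset.sum_fiberwise_of_maps_to (t := s.image D) (g := desSet),
    Finset.sum_image hD]
  · refine Finset.sum_congr rfl fun k hk => ?_
    have : {σ ∈ {σ ∈ avoiders pattern321 n | des σ = i} | desSet σ = D k} =
        avoidersDes n (D k) := by
      ext σ
      simp only [avoidersDes, Finset.mem_filter, and_assoc, and_congr_right_iff,
        and_iff_right_iff_imp]
      intro _ h
      rw [des, h, hcard k hk]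
    rw [this, ← nsmul_eq_mul]
    refine Finset.sum_eq_card_nsmul fun σ hσ => ?_
    rw [maj, (Finset.mem_filter.1 hσ).2]
  · intro σ hσ
    rw [Finset.mem_filter, mem_avoiders] at hσ
    obtain ⟨k, hk, h⟩ := hex σ hσ.1 hσ.2
    exact Finset.mem_image.2 ⟨k, hk, h.symm⟩

lemma g_even (m : ℕ) : g pattern321 (2 * m) m = C (catalan m : ℚ) * X ^ m ^ 2 := by
  rw [g_eq_sum_card {m} (fun k => sparseSet m k) (by simp) (fun k _ => card_sparseSet m k)]
  · rw [Finset.sum_singleton, card_avoidersDes_even, sum_sparseSet le_rfl]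
    simp
  · intro σ hσ hdes
    exact ⟨m, by simp, eq_sparseSet_self (desSet_subset σ) (desSet_sparse hσ) hdes⟩

lemma g_odd (m : ℕ) : g pattern321 (2 * m + 1) m =
    C (catalan (m + 1) : ℚ) * ∑ j ∈ Finset.Icc (m ^ 2) (m ^ 2 + m), X ^ j := by
  rw [g_eq_sum_card (Finset.range (m + 1)) (fun k => sparseSet m k) ?_
    (fun k _ => card_sparseSet m k)]
  · rw [Finset.mul_sum]
    refine Finset.sum_bij' (fun k _ => m ^ 2 + (m - k)) (fun j _ => m ^ 2 + m - j) ?_ ?_ ?_ ?_ ?_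
    · intro k hk; rw [Finset.mem_range] at hk; rw [Finset.mem_Icc]; omega
    · intro j hj; rw [Finset.mem_Icc] at hj; rw [Finset.mem_range]; omega
    · intro k hk; rw [Finset.mem_range] at hk; omega
    · intro j hj; rw [Finset.mem_Icc] at hj; omega
    · intro k hk
      have hk' : k ≤ m := by rw [Finset.mem_range] at hk; omega
      rw [card_avoidersDes_odd hk', sum_sparseSet hk']
      simp
  · intro σ hσ hdes
    obtain ⟨k, hk, h⟩ := exists_eq_sparseSet (m := m) (by simpa using desSet_subset σ)
      (desSet_sparse hσ) hdes
    exact ⟨k, Finset.mem_range.2 (by omega), h⟩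
  · intro k hk k' hk' h
    have hk : k ≤ m := by simpa [Nat.lt_succ_iff] using hk
    have hk' : k' ≤ m := by simpa [Nat.lt_succ_iff] using hk'
    -- The sum m² + (m - k) determines k.
    have h1 := sum_sparseSet hk
    dsimp only at h
    rw [h, sum_sparseSet hk'] at h1
    omega

/-- The bound is attained because the relevant Catalan number of extremal avoiders is positive. -/
lemma exists_des_eq (n : ℕ) : ∃ σ : Equiv.Perm (Fin n), Avoids pattern321 σ ∧ des σ = n / 2 := by
  have hne : (avoidersDes n (sparseSet (n / 2) (n / 2))).Nonempty := by
    rw [← Finset.card_pos]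
    obtain h | h : n = 2 * (n / 2) ∨ n = 2 * (n / 2) + 1 := by omega
    · generalize n / 2 = m at *
      subst h
      rw [card_avoidersDes_even]; exact catalan_pos m
    · generalize n / 2 = m at *
      subst h
      rw [card_avoidersDes_odd le_rfl]; exact catalan_pos _
  obtain ⟨σ, hσ⟩ := hne
  rw [avoidersDes, Finset.mem_filter, mem_avoiders] at hσ
  exact ⟨σ, hσ.1, by rw [des, hσ.2, card_sparseSet]⟩

end PatternMaj

theorem mainTheorem4 (n : ℕ) :
    IsGreatest (PatternMaj.des '' {σ : Equiv.Perm (Fin n) |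
      PatternMaj.Avoids PatternMaj.pattern321 σ}) (n / 2) ∧
    (Even n →
      PatternMaj.g PatternMaj.pattern321 n (n / 2) =
        C (catalan (n / 2) : ℚ) * X ^ ((n / 2) ^ 2)) ∧
    (Odd n →
      PatternMaj.g PatternMaj.pattern321 n (n / 2) =
        C ((4 * (n / 2 : ℕ) + 2 : ℚ) / ((n / 2 : ℕ) + 2 : ℚ) * (catalan (n / 2) : ℚ)) *
          ∑ j ∈ Finset.Icc ((n / 2) ^ 2) ((n / 2) ^ 2 + n / 2), X ^ j) := by
  refine ⟨⟨?_, ?_⟩, fun h => ?_, fun h => ?_⟩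
  · obtain ⟨σ, hσ, h⟩ := PatternMaj.exists_des_eq n
    exact ⟨σ, hσ, h⟩
  · rintro _ ⟨σ, hσ, rfl⟩
    exact PatternMaj.des_le hσ
  · obtain ⟨m, rfl⟩ := h.exists_two_nsmul
    rw [smul_eq_mul, show 2 * m / 2 = m by omega]
    exact PatternMaj.g_even m
  · obtain ⟨m, rfl⟩ := h
    rw [show (2 * m + 1) / 2 = m by omega, ← PatternMaj.catalan_succ_eq_div_mul]
    exact PatternMaj.g_odd m
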